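/- Let $\mathrm{Sym}(\omega)$ be the group of permutations of the set $\omega$ of natural numbers, with the topology of pointwise convergence, and let $G$ be an oligomorphic group, that is, a closed subgroup of $\mathrm{Sym}(\omega)$ whose action on $\omega^n$ has only finitely many orbits for each $n$. Let $N_G$ and $C_G$ be the normaliser and the centraliser of $G$ in $\mathrm{Sym}(\omega)$. Let $\mathrm{Aut}(G)$ be the group of automorphisms of the topological group $G$ (group automorphisms that are homeomorphisms), with the topology of pointwise convergence for its action on the cosets of open subgroups of $G$: a neighbourhood basis of the identity is formed by the subgroups $\{\Phi : \Phi(A_i)=A_i,\ i=1,\dots,n\}$, where $A_1,\dots,A_n$ are cosets of open subgroups of $G$. Let $\mathrm{Inn}(G)$ be the normal subgroup of inner automorphisms, and give $\mathrm{Out}(G)=\mathrm{Aut}(G)/\mathrm{Inn}(G)$ the quotient topology. Let $R\colon N_G\to \mathrm{Aut}(G)$ be the homomorphism $R(\pi)(g)=\pi\circ g\circ\pi^{-1}$; its range contains $\mathrm{Inn}(G)$. (i) The subgroup $\mathrm{range}(R)$ is open in $\mathrm{Aut}(G)$. (ii) $\mathrm{Out}(G)$ is a totally disconnected, locally compact Hausdorff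 topological group. The topological group $\mathrm{range}(R)/\mathrm{Inn}(G)$ is profinite (that is, compact, Hausdorff and totally disconnected), and its canonical homomorphism to $\mathrm{Out}(G)$ is a homeomorphism onto an open subgroup of $\mathrm{Out}(G)$. Moreover, $\pi\, GC_G\mapsto R(\pi)\,\mathrm{Inn}(G)$ is a well-defined isomorphism of topological groups $N_G/GC_G\to \mathrm{range}(R)/\mathrm{Inn}(G)$. -/

import Mathlib

namespace OligoAut

/-! ### The symmetric group of the natural numbers -/

/-- `Sym(ω)` with the topology of pointwise convergence (`ω` is discrete): a neighbourhood basis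
of `1` is given by the pointwise stabilisers of finite sets. -/
instance permTopology : TopologicalSpace (Equiv.Perm ℕ) :=
  TopologicalSpace.induced (fun σ : Equiv.Perm ℕ => (σ : ℕ → ℕ)) inferInstance

theorem continuous_perm_apply (n : ℕ) : Continuous fun σ : Equiv.Perm ℕ => σ n :=
  (continuous_apply n).comp continuous_induced_dom

theorem isOpen_perm_fiber (a b : ℕ) : IsOpen {σ : Equiv.Perm ℕ | σ a = b} :=
  (isOpen_discrete {b}).preimage (continuous_perm_apply a)

theorem continuous_to_perm {X : Type*} [TopologicalSpace X] {f : X → Equiv.Perm ℕ}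
    (h : ∀ a b : ℕ, IsOpen {x | f x a = b}) : Continuous f := by
  refine continuous_induced_rng.2 (continuous_pi fun a => ?_)
  refine continuous_discrete_rng.2 fun b => ?_
  exact h a b

instance : IsTopologicalGroup (Equiv.Perm ℕ) where
  continuous_mul := by
    refine continuous_to_perm fun a b => ?_
    have : {p : Equiv.Perm ℕ × Equiv.Perm ℕ | (p.1 * p.2) a = b} =
        ⋃ c, {σ : Equiv.Perm ℕ | σ c = b} ×ˢ {σ : Equiv.Perm ℕ | σ a = c} := by
      ext p; simp
    rw [this]
    exact isOpen_iUnion fun c => (isOpen_perm_fiber c b).prod (isOpen_perm_fiber a c)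
  continuous_inv := by
    refine continuous_to_perm fun a b => ?_
    have : {σ : Equiv.Perm ℕ | σ⁻¹ a = b} = {σ : Equiv.Perm ℕ | σ b = a} := by
      ext σ
      simp only [Set.mem_ofPred_eq, Equiv.Perm.inv_eq_iff_eq]
      exact eq_comm
    rw [this]
    exact isOpen_perm_fiber b a

/-- An oligomorphic group: a closed subgroup of `Sym(ω)` whose action on `ω ^ n` has only
finitely many orbits, for every `n`. -/
structure IsOligomorphic (G : Subgroup (Equiv.Perm ℕ)) : Prop where
  isClosed : IsClosed (G : Set (Equiv.Perm ℕ))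
  finite_orbits : ∀ n : ℕ, Finite (MulAction.orbitRel.Quotient G (Fin n → ℕ))

/-! ### The topological groups `Aut(G)` and `Out(G)` -/

section Aut

variable (G : Type*) [Group G] [TopologicalSpace G]

/-- `Aut(G)`: the group of automorphisms of the topological group `G`, that is, of group
automorphisms that are homeomorphisms. -/
abbrev TopAut : Type _ := G ≃ₜ* G

/-- The group structure of `Aut(G)` is composition. -/
instance : Group (TopAut G) where
  mul f g := g.trans f
  one := ContinuousMulEquiv.refl G
  inv f := f.symm
  mul_assoc _ _ _ := rfl
  one_mul _ := rfl
  mul_one _ := rfl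
  inv_mul_cancel f := ContinuousMulEquiv.self_trans_symm f

@[simp] theorem TopAut.mul_apply (f g : TopAut G) (x : G) : (f * g) x = f (g x) := rfl

@[simp] theorem TopAut.one_apply (x : G) : (1 : TopAut G) x = x := rfl

theorem TopAut.inv_apply (f : TopAut G) (x : G) : f⁻¹ x = f.symm x := rfl

/-- The cosets of open subgroups of `G` (a left coset `gU` is the right coset `(gUg⁻¹)g`). -/
def openCosets : Set (Set G) :=
  {A | ∃ (U : Subgroup G) (g : G), IsOpen (U : Set G) ∧ A = (fun u => g * u) '' (U : Set G)}

/-- The topology on `Aut(G)` of pointwise convergence for its action on the cosets of open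
subgroups: the cosets `{Ψ | Ψ(A) = Φ(A)}` of the stabilisers of open cosets `A` form a subbasis. -/
instance autTopology : TopologicalSpace (TopAut G) :=
  TopologicalSpace.generateFrom
    {S | ∃ A ∈ openCosets G, ∃ Φ : TopAut G, S = {Ψ : TopAut G | Ψ '' A = Φ '' A}}

variable {G}

theorem image_mem_openCosets (Φ : TopAut G) {A : Set G} (hA : A ∈ openCosets G) :
    Φ '' A ∈ openCosets G := by
  obtain ⟨U, g, hU, rfl⟩ := hA
  refine ⟨U.map Φ.toMulEquiv.toMonoidHom, Φ g, Φ.toHomeomorph.isOpenMap _ hU, ?_⟩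
  ext x
  constructor
  · rintro ⟨_, ⟨u, hu, rfl⟩, rfl⟩
    exact ⟨Φ u, ⟨u, hu, rfl⟩, (map_mul Φ g u).symm⟩
  · rintro ⟨_, ⟨u, hu, rfl⟩, rfl⟩
    exact ⟨g * u, ⟨u, hu, rfl⟩, map_mul Φ g u⟩

theorem mul_image (Φ Ψ : TopAut G) (A : Set G) : (Φ * Ψ) '' A = Φ '' (Ψ '' A) :=
  Set.image_comp Φ Ψ A

theorem inv_image_eq_iff (Φ : TopAut G) (A B : Set G) : (Φ⁻¹ : TopAut G) '' A = B ↔ A = Φ '' B := by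
  constructor
  · rintro rfl
    rw [← mul_image, mul_inv_cancel]
    exact (Set.image_id A).symm
  · rintro rfl
    rw [← mul_image, inv_mul_cancel]
    exact Set.image_id B

theorem isOpen_cylinder {A : Set G} (hA : A ∈ openCosets G) (Φ : TopAut G) :
    IsOpen {Ψ : TopAut G | Ψ '' A = Φ '' A} :=
  TopologicalSpace.isOpen_generateFrom_of_mem ⟨A, hA, Φ, rfl⟩

instance : IsTopologicalGroup (TopAut G) where
  continuous_mul := by
    refine continuous_generateFrom_iff.2 ?_
    rintro _ ⟨A, hA, Φ, rfl⟩
    refine isOpen_iff_mem_nhds.2 ?_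
    rintro ⟨α, β⟩ h
    have h' : (α * β) '' A = Φ '' A := h
    refine Filter.mem_of_superset (((isOpen_cylinder (image_mem_openCosets β hA) α).prod
      (isOpen_cylinder hA β)).mem_nhds ⟨rfl, rfl⟩) ?_
    rintro ⟨α', β'⟩ ⟨h1, h2⟩
    have h1' : α' '' (β '' A) = α '' (β '' A) := h1
    have h2' : β' '' A = β '' A := h2
    change (α' * β') '' A = Φ '' A
    rw [mul_image, h2', h1', ← mul_image, h']
  continuous_inv := by
    refine continuous_generateFrom_iff.2 ?_
    rintro _ ⟨A, hA, Φ, rfl⟩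
    have : (fun Ψ : TopAut G => Ψ⁻¹) ⁻¹' {Ψ : TopAut G | Ψ '' A = Φ '' A} =
        {Ψ : TopAut G | Ψ '' (Φ '' A) = (Φ⁻¹ : TopAut G) '' (Φ '' A)} := by
      ext Ψ
      have e : (Φ⁻¹ : TopAut G) '' (Φ '' A) = A := (inv_image_eq_iff Φ _ _).2 rfl
      simp only [Set.mem_preimage, Set.mem_ofPred_eq]
      rw [e, inv_image_eq_iff]
      exact eq_comm
    rw [this]
    exact isOpen_cylinder (image_mem_openCosets Φ hA) Φ⁻¹

variable (G) [IsTopologicalGroup G]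

/-- The homomorphism `G → Aut(G)` sending `g` to the inner automorphism `x ↦ g x g⁻¹`. -/
def innHom : G →* TopAut G where
  toFun g :=
    { MulAut.conj g with
      continuous_toFun := by
        change Continuous fun x : G => g * x * g⁻¹
        fun_prop
      continuous_invFun := by
        change Continuous fun x : G => g⁻¹ * x * g
        fun_prop }
  map_one' := by
    ext x
    change (1 : G) * x * (1 : G)⁻¹ = x
    simp
  map_mul' g h := by
    ext x
    change g * h * x * (g * h)⁻¹ = g * (h * x * h⁻¹) * g⁻¹
    group

@[simp] theorem innHom_apply (g x : G) : innHom G g x = g * x * g⁻¹ := rfl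

/-- `Inn(G)`, the group of inner automorphisms. -/
def Inn : Subgroup (TopAut G) := (innHom G).range

instance : (Inn G).Normal where
  conj_mem := by
    rintro _ ⟨g, rfl⟩ Φ
    refine ⟨Φ g, ?_⟩
    ext x
    change Φ g * x * (Φ g)⁻¹ = Φ (g * (Φ.symm x) * g⁻¹)
    simp

/-- `Out(G) = Aut(G)/Inn(G)`, with the quotient topology. -/
abbrev Out : Type _ := TopAut G ⧸ Inn G

end Aut

/-! ### The normaliser and its action by conjugation -/

section Normaliser

variable (G : Subgroup (Equiv.Perm ℕ))

/-- `N_G`, the normaliser of `G` in `Sym(ω)`. -/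
abbrev NG : Subgroup (Equiv.Perm ℕ) := Subgroup.normalizer (G : Set (Equiv.Perm ℕ))

theorem conj_mem {π g : Equiv.Perm ℕ} (hπ : π ∈ NG G) (hg : g ∈ G) : π * g * π⁻¹ ∈ G :=
  (Subgroup.mem_normalizer_iff.1 hπ g).1 hg

theorem inv_conj_mem {π g : Equiv.Perm ℕ} (hπ : π ∈ NG G) (hg : g ∈ G) : π⁻¹ * g * π ∈ G :=
  (Subgroup.mem_normalizer_iff''.1 hπ g).1 hg

/-- The homomorphism `R : N_G → Aut(G)` given by `R(π)(g) = π ∘ g ∘ π⁻¹`. -/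
def R : NG G →* TopAut G where
  toFun π :=
    { toFun := fun g => ⟨(π : Equiv.Perm ℕ) * g * (π : Equiv.Perm ℕ)⁻¹, conj_mem G π.2 g.2⟩
      invFun := fun g => ⟨(π : Equiv.Perm ℕ)⁻¹ * g * π, inv_conj_mem G π.2 g.2⟩
      left_inv := fun g => Subtype.ext (by simp [mul_assoc])
      right_inv := fun g => Subtype.ext (by simp [mul_assoc])
      map_mul' := fun g h => Subtype.ext (by simp [mul_assoc])
      continuous_toFun := by fun_prop
      continuous_invFun := by fun_prop }
  map_one' := by
    ext g : 2
    change (1 : Equiv.Perm ℕ) * g * (1 : Equiv.Perm ℕ)⁻¹ = g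
    simp
  map_mul' π ρ := by
    ext g : 2
    change (π : Equiv.Perm ℕ) * ρ * g * ((π : Equiv.Perm ℕ) * ρ)⁻¹ =
      π * (ρ * g * (ρ : Equiv.Perm ℕ)⁻¹) * (π : Equiv.Perm ℕ)⁻¹
    group

@[simp] theorem R_apply (π : NG G) (g : G) :
    (R G π g : Equiv.Perm ℕ) = (π : Equiv.Perm ℕ) * g * (π : Equiv.Perm ℕ)⁻¹ := rfl

theorem Inn_le_range_R : Inn G ≤ (R G).range := by
  rintro _ ⟨g, rfl⟩
  exact ⟨⟨g, Subgroup.le_normalizer g.2⟩, rfl⟩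

/-- `G C_G`, the product of `G` with its centraliser `C_G` in `Sym(ω)`, as a subgroup of `N_G`. -/
def GC : Subgroup (NG G) :=
  (G ⊔ Subgroup.centralizer (G : Set (Equiv.Perm ℕ))).subgroupOf (NG G)

theorem mem_GC {π : NG G} :
    π ∈ GC G ↔ ∃ g ∈ G, ∃ c ∈ Subgroup.centralizer (G : Set (Equiv.Perm ℕ)),
      (π : Equiv.Perm ℕ) = g * c := by
  have key := Subgroup.coe_mul_of_right_le_normalizer_left G
    (Subgroup.centralizer (G : Set (Equiv.Perm ℕ))) (Subgroup.centralizer_le_normalizer _)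
  have : π ∈ GC G ↔ (π : Equiv.Perm ℕ) ∈
      ((G ⊔ Subgroup.centralizer (G : Set (Equiv.Perm ℕ)) :
        Subgroup (Equiv.Perm ℕ)) : Set (Equiv.Perm ℕ)) := Subgroup.mem_subgroupOf
  rw [this, key, Set.mem_mul]
  constructor
  · rintro ⟨g, hg, c, hc, h⟩
    exact ⟨g, hg, c, hc, h.symm⟩
  · rintro ⟨g, hg, c, hc, h⟩
    exact ⟨g, hg, c, hc, h.symm⟩

theorem mem_GC_iff_R_mem_Inn {π : NG G} : π ∈ GC G ↔ R G π ∈ Inn G := by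
  rw [mem_GC]
  constructor
  · rintro ⟨g, hg, c, hc, h⟩
    refine ⟨⟨g, hg⟩, ?_⟩
    ext x : 2
    change g * (x : Equiv.Perm ℕ) * g⁻¹ = (π : Equiv.Perm ℕ) * x * (π : Equiv.Perm ℕ)⁻¹
    have e : (x : Equiv.Perm ℕ) * c = c * x := Subgroup.mem_centralizer_iff.1 hc x x.2
    rw [h, mul_assoc g c, ← e]
    group
  · rintro ⟨g, h⟩
    refine ⟨g, g.2, (g : Equiv.Perm ℕ)⁻¹ * π, ?_, by simp⟩
    refine Subgroup.mem_centralizer_iff.2 fun x hx => ?_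
    have e : (g : Equiv.Perm ℕ) * x * (g : Equiv.Perm ℕ)⁻¹ =
        (π : Equiv.Perm ℕ) * x * (π : Equiv.Perm ℕ)⁻¹ :=
      congrArg (fun Φ : TopAut G => ((Φ ⟨x, hx⟩ : G) : Equiv.Perm ℕ)) h
    have e1 : x = (g : Equiv.Perm ℕ)⁻¹ *
        ((g : Equiv.Perm ℕ) * x * (g : Equiv.Perm ℕ)⁻¹) * g := by group
    rw [e] at e1
    calc x * ((g : Equiv.Perm ℕ)⁻¹ * π)
        = (g : Equiv.Perm ℕ)⁻¹ * ((π : Equiv.Perm ℕ) * x * (π : Equiv.Perm ℕ)⁻¹) * g *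
            ((g : Equiv.Perm ℕ)⁻¹ * π) := by rw [← e1]
      _ = (g : Equiv.Perm ℕ)⁻¹ * π * x := by group

theorem GC_eq_comap : GC G = (Inn G).comap (R G) := by
  ext π
  exact mem_GC_iff_R_mem_Inn G

instance : (GC G).Normal := by
  rw [GC_eq_comap]
  infer_instance

/-- The topological group `range(R)/Inn(G)` (with the quotient topology). -/
abbrev RangeModInn : Type := (R G).range ⧸ (Inn G).subgroupOf (R G).range

/-- The canonical homomorphism `range(R)/Inn(G) → Out(G)` induced by the inclusion
`range(R) ≤ Aut(G)`. -/
def rangeModInnToOut : RangeModInn G →* Out G :=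
  QuotientGroup.map _ _ (R G).range.subtype le_rfl

end Normaliser

end OligoAut

/-!
The map `R : N_G → Aut(G)` is continuous and open, and `N_G/GC_G` is compact, Hausdorff and
nonarchimedean; everything else is transported along the resulting homeomorphism
`N_G/GC_G ≅ range(R)/Inn(G)` and the open embedding of the latter into `Out(G)`.

*`R` is open* (`exists_R_eq`, `IsOligomorphic.isOpenMap_R`). `G` has finitely many orbits on `ω`.
Let `K` be a finite set that meets all of them. If `Φ ∈ Aut(G)` preserves each of the finitely
many cosets `{g | g a = b}` with `a, b ∈ K`, then `g a ↦ Φ(g) a` is a well-defined permutation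
`π`, it fixes `K` pointwise, it normalises `G`, and `R(π) = Φ`. As `K` may be enlarged at will,
`R` maps neighbourhoods of `1` to neighbourhoods of `1`.

*`R` is continuous* (`IsOligomorphic.continuous_R`). A coset of an open subgroup is a union of
double cosets of the pointwise stabiliser of some finite set, and oligomorphicity leaves only
finitely many double cosets. Fixing finitely many points suffices to preserve each of them.

*`N_G/GC_G` is compact* (`exists_limit`, `IsOligomorphic.compactSpace_quotient`). Along an
ultrafilter on `N_G`, the orbit of the image of each finite tuple is eventually constant, since
there are finitely many orbits. A back-and-forth construction turns these limits of orbits into a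
permutation, which normalises `G` as `G` is closed, and whose class is a limit in the quotient.

*`N_G/GC_G` is Hausdorff* (`IsOligomorphic.isClosed_GC`), since `C_G` is finite
(`IsOligomorphic.finite_centralizer`) and `G` is closed.
-/

namespace OligoAut

open Filter Topology

/-! ### Neighbourhoods in `Sym(ω)` -/

theorem perm_inv_apply_self (σ : Equiv.Perm ℕ) (x : ℕ) : σ⁻¹ (σ x) = x := σ.symm_apply_apply x

theorem perm_apply_inv_self (σ : Equiv.Perm ℕ) (x : ℕ) : σ (σ⁻¹ x) = x := σ.apply_symm_apply x

theorem mem_nhds_perm {s : Set (Equiv.Perm ℕ)} {π : Equiv.Perm ℕ} :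
    s ∈ 𝓝 π ↔ ∃ F : Finset ℕ, {σ : Equiv.Perm ℕ | ∀ a ∈ F, σ a = π a} ⊆ s := by
  constructor
  · intro hs
    rw [nhds_induced, mem_comap] at hs
    obtain ⟨t, ht, hts⟩ := hs
    rw [nhds_pi, Filter.mem_pi'] at ht
    obtain ⟨F, u, hu, hut⟩ := ht
    refine ⟨F, fun σ hσ => hts (hut fun a ha => ?_)⟩
    have : σ a = π a := hσ a ha
    change σ a ∈ u a
    rw [this]
    exact mem_of_mem_nhds (hu a)
  · rintro ⟨F, hF⟩
    refine mem_of_superset ((Filter.biInter_finset_mem F).2 fun a _ =>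
      (isOpen_perm_fiber a (π a)).mem_nhds rfl) fun σ hσ => hF ?_
    simpa using hσ

theorem mem_nhds_subgroup {H : Subgroup (Equiv.Perm ℕ)} {s : Set H} {π : H} :
    s ∈ 𝓝 π ↔ ∃ F : Finset ℕ, {σ : H | ∀ a ∈ F, (σ : Equiv.Perm ℕ) a =
      (π : Equiv.Perm ℕ) a} ⊆ s := by
  rw [nhds_subtype, mem_comap]
  constructor
  · rintro ⟨t, ht, hts⟩
    obtain ⟨F, hF⟩ := mem_nhds_perm.1 ht
    exact ⟨F, fun σ hσ => hts (hF hσ)⟩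
  · rintro ⟨F, hF⟩
    exact ⟨_, mem_nhds_perm.2 ⟨F, subset_rfl⟩, hF⟩

/-- The pointwise stabiliser of the finite set `F` in `H`. -/
def pointwiseFixer (H : Subgroup (Equiv.Perm ℕ)) (F : Finset ℕ) : Subgroup H where
  carrier := {σ | ∀ a ∈ F, (σ : Equiv.Perm ℕ) a = a}
  one_mem' := fun _ _ => rfl
  mul_mem' := fun {σ τ} hσ hτ a ha => by
    change (σ : Equiv.Perm ℕ) ((τ : Equiv.Perm ℕ) a) = a
    rw [hτ a ha, hσ a ha]
  inv_mem' := fun {σ} hσ a ha => Equiv.Perm.inv_eq_iff_eq.2 (hσ a ha).symm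

theorem isOpen_pointwiseFixer (H : Subgroup (Equiv.Perm ℕ)) (F : Finset ℕ) :
    IsOpen (pointwiseFixer H F : Set H) :=
  Subgroup.isOpen_of_mem_nhds _ (g := 1) (mem_nhds_subgroup.2 ⟨F, subset_rfl⟩)

theorem exists_pointwiseFixer_subset {H : Subgroup (Equiv.Perm ℕ)} {s : Set H}
    (hs : s ∈ 𝓝 (1 : H)) :
    ∃ F : Finset ℕ, (pointwiseFixer H F : Set H) ⊆ s :=
  mem_nhds_subgroup.1 hs

theorem mem_of_isClosed {G : Subgroup (Equiv.Perm ℕ)} (hG : IsClosed (G : Set (Equiv.Perm ℕ)))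
    {σ : Equiv.Perm ℕ} (h : ∀ F : Finset ℕ, ∃ g ∈ G, ∀ a ∈ F, g a = σ a) : σ ∈ G := by
  have : σ ∈ closure (G : Set (Equiv.Perm ℕ)) := by
    refine mem_closure_iff_nhds.2 fun t ht => ?_
    obtain ⟨F, hF⟩ := mem_nhds_perm.1 ht
    obtain ⟨g, hg, hgF⟩ := h F
    exact ⟨g, hF hgF, hg⟩
  rwa [hG.closure_eq] at this

/-- The images of the pointwise stabilisers form a neighbourhood basis of open subgroups. -/
theorem nonarchimedean_quotient (H : Subgroup (Equiv.Perm ℕ)) (N : Subgroup H) [N.Normal] :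
    NonarchimedeanGroup (H ⧸ N) where
  is_nonarchimedean U hU := by
    have h1 : (QuotientGroup.mk : H → H ⧸ N) ⁻¹' U ∈ 𝓝 (1 : H) :=
      QuotientGroup.continuous_mk.continuousAt.preimage_mem_nhds hU
    obtain ⟨F, hF⟩ := exists_pointwiseFixer_subset h1
    refine ⟨⟨(pointwiseFixer H F).map (QuotientGroup.mk' N), ?_⟩, ?_⟩
    · exact QuotientGroup.isOpenMap_coe _ (isOpen_pointwiseFixer H F)
    · rintro _ ⟨σ, hσ, rfl⟩
      exact hF hσ

/-! ### Finitely many orbits -/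

section Orbits

variable {G : Subgroup (Equiv.Perm ℕ)} (hG : IsOligomorphic G)
include hG

/-- A family `t` of tuples of natural numbers, indexed by a finite set `s`, meets only finitely
many orbits of `G`. All uses of oligomorphicity go through this form. -/
theorem IsOligomorphic.exists_finite_reps {X α : Type*} (s : Finset α) (t : X → α → ℕ) :
    ∃ K : Set X, K.Finite ∧ ∀ x, ∃ y ∈ K, ∃ g ∈ G, ∀ a ∈ s, g (t x a) = t y a := by
  let q : X → MulAction.orbitRel.Quotient G (Fin s.card → ℕ) :=
    fun x => Quotient.mk'' fun i => t x (s.equivFin.symm i)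
  have := hG.finite_orbits s.card
  refine ⟨Set.range fun z : Set.range q => z.2.choose, Set.finite_range _, fun x => ?_⟩
  have hq := (Set.mem_range_self (f := q) x).choose_spec
  refine ⟨_, ⟨⟨q x, x, rfl⟩, rfl⟩, ?_⟩
  obtain ⟨g, hg⟩ := MulAction.orbitRel_apply.1 (Quotient.exact hq)
  refine ⟨g, g.2, fun a ha => ?_⟩
  have := congrFun hg (s.equivFin ⟨a, ha⟩)
  simp only [Pi.smul_apply, Equiv.symm_apply_apply] at this
  exact this

/-- An ultrafilter on a family of tuples concentrates on a single orbit of `G`. -/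
theorem IsOligomorphic.exists_eventually {X α : Type*} (𝓕 : Ultrafilter X) (s : Finset α)
    (t : X → α → ℕ) : ∃ y, ∀ᶠ x in 𝓕, ∃ g ∈ G, ∀ a ∈ s, g (t x a) = t y a := by
  obtain ⟨K, hK, h⟩ := hG.exists_finite_reps s t
  obtain ⟨y, -, hy⟩ := (Ultrafilter.eventually_exists_mem_iff hK).1
    (Filter.Eventually.of_forall (f := (𝓕 : Filter X)) h)
  exact ⟨y, hy⟩

theorem IsOligomorphic.exists_finset_orbits :
    ∃ T : Finset ℕ, ∀ x, ∃ a ∈ T, ∃ g ∈ G, g a = x := by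
  obtain ⟨K, hK, h⟩ := hG.exists_finite_reps {()} (fun (x : ℕ) _ => x)
  refine ⟨hK.toFinset, fun x => ?_⟩
  obtain ⟨a, ha, g, hg, e⟩ := h x
  refine ⟨a, by simpa using ha, g⁻¹, inv_mem hg, ?_⟩
  rw [Equiv.Perm.inv_eq_iff_eq]
  exact (e () (by simp)).symm

/-- An element `c` of the centraliser is determined by the orbits of the pairs `(a, c a)`, where
`a` runs through representatives of the orbits of `G`. -/
theorem IsOligomorphic.finite_centralizer :
    (Subgroup.centralizer (G : Set (Equiv.Perm ℕ)) : Set (Equiv.Perm ℕ)).Finite := by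
  obtain ⟨T, hT⟩ := hG.exists_finset_orbits
  let C := Subgroup.centralizer (G : Set (Equiv.Perm ℕ))
  obtain ⟨K, hK, h⟩ := hG.exists_finite_reps (T.disjSum T)
    (fun (c : C) => Sum.elim (fun a => a) fun a => (c : Equiv.Perm ℕ) a)
  refine (hK.image Subtype.val).subset fun c hc => ?_
  obtain ⟨d, hd, g, hg, e⟩ := h ⟨c, hc⟩
  refine ⟨d, hd, Equiv.ext fun x => ?_⟩
  obtain ⟨a, ha, k, hk, rfl⟩ := hT x
  have e1 : g a = a := e (Sum.inl a) (by simpa using ha)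
  have e2 : g (c a) = (d : Equiv.Perm ℕ) a := e (Sum.inr a) (by simpa using ha)
  have comm : ∀ c ∈ C, ∀ g ∈ G, ∀ y, c (g y) = g (c y) := fun c hc g hg y =>
    (congrArg (fun σ : Equiv.Perm ℕ => σ y) (Subgroup.mem_centralizer_iff.1 hc g hg)).symm
  rw [comm _ d.2 k hk, comm _ hc k hk, ← e2, ← comm c hc g hg, e1]

/-- `G C_G` is a finite union of cosets of the closed group `G`. -/
theorem IsOligomorphic.isClosed_GC : IsClosed (GC G : Set (NG G)) := by
  have : (GC G : Set (NG G)) = ⋃ c ∈ (Subgroup.centralizer (G : Set (Equiv.Perm ℕ)) :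
      Set (Equiv.Perm ℕ)), (fun π : NG G => (π : Equiv.Perm ℕ) * c⁻¹) ⁻¹' (G : Set _) := by
    ext π
    simp only [SetLike.mem_coe, mem_GC, Set.mem_iUnion, Set.mem_preimage, exists_prop]
    constructor
    · rintro ⟨g, hg, c, hc, h⟩
      exact ⟨c, hc, by simpa [h] using hg⟩
    · rintro ⟨c, hc, h⟩
      exact ⟨_, h, c, hc, by simp⟩
  rw [this]
  exact hG.finite_centralizer.isClosed_biUnion fun c _ => hG.isClosed.preimage (by fun_prop)

end Orbits

/-! ### The homomorphism `R` is open -/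

section Open

variable {G : Subgroup (Equiv.Perm ℕ)}

/-- The set of the elements of `G` that send `a` to `b`: a coset of the stabiliser of `a`, or
empty. -/
def transporter (G : Subgroup (Equiv.Perm ℕ)) (a b : ℕ) : Set G := {g | (g : Equiv.Perm ℕ) a = b}

theorem transporter_mem_openCosets {a b : ℕ} (h : (transporter G a b).Nonempty) :
    transporter G a b ∈ openCosets G := by
  obtain ⟨g, hg⟩ := h
  have hg' : (g : Equiv.Perm ℕ) a = b := hg
  refine ⟨pointwiseFixer G {a}, g, isOpen_pointwiseFixer G {a}, ?_⟩
  ext x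
  constructor
  · intro hx
    have hx' : (x : Equiv.Perm ℕ) a = b := hx
    refine ⟨g⁻¹ * x, fun c hc => ?_, by simp⟩
    obtain rfl := Finset.mem_singleton.1 hc
    change (g : Equiv.Perm ℕ)⁻¹ ((x : Equiv.Perm ℕ) c) = c
    rw [Equiv.Perm.inv_eq_iff_eq, hx', hg']
  · rintro ⟨u, hu, rfl⟩
    have : (u : Equiv.Perm ℕ) a = a := hu a (by simp)
    change (g : Equiv.Perm ℕ) ((u : Equiv.Perm ℕ) a) = b
    rw [this, hg']

theorem transporter_cylinder_mem_nhds (a b : ℕ) :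
    {Φ : TopAut G | Φ '' transporter G a b = transporter G a b} ∈ 𝓝 (1 : TopAut G) := by
  have e : (1 : TopAut G) '' transporter G a b = transporter G a b := Set.image_id _
  rcases (transporter G a b).eq_empty_or_nonempty with h | h
  · simp [h]
  · have := (isOpen_cylinder (transporter_mem_openCosets h) 1).mem_nhds rfl
    rwa [e] at this

/-- Let the finite set `K` meet every orbit of `G`. An automorphism `Φ` that preserves the cosets
`{g | g a = b}` with `a, b ∈ K` is conjugation by the permutation `g a ↦ Φ(g) a` (`a ∈ K`), which
fixes `K` pointwise. -/
theorem exists_R_eq {K : Finset ℕ} (hK : ∀ x, ∃ a ∈ K, ∃ g ∈ G, g a = x) (Φ : TopAut G)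
    (hΦ : ∀ a ∈ K, ∀ b ∈ K, Φ '' transporter G a b = transporter G a b) :
    ∃ π : NG G, R G π = Φ ∧ ∀ a ∈ K, (π : Equiv.Perm ℕ) a = a := by
  have key : ∀ a ∈ K, ∀ b ∈ K, ∀ g : G,
      (Φ g : Equiv.Perm ℕ) a = b ↔ (g : Equiv.Perm ℕ) a = b := by
    intro a ha b hb g
    have : Φ g ∈ transporter G a b ↔ g ∈ transporter G a b := by
      conv_lhs => rw [← hΦ a ha b hb]
      exact Φ.injective.mem_set_image
    exact this
  -- the next equivalence makes `g a ↦ Φ(g) a` well defined and injective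
  have key2 : ∀ a ∈ K, ∀ b ∈ K, ∀ g h : G,
      (Φ g : Equiv.Perm ℕ) a = (Φ h : Equiv.Perm ℕ) b ↔
        (g : Equiv.Perm ℕ) a = (h : Equiv.Perm ℕ) b := by
    intro a ha b hb g h
    have := key a ha b hb (h⁻¹ * g)
    rw [map_mul, map_inv] at this
    change (Φ h : Equiv.Perm ℕ)⁻¹ ((Φ g : Equiv.Perm ℕ) a) = b ↔
      (h : Equiv.Perm ℕ)⁻¹ ((g : Equiv.Perm ℕ) a) = b at this
    rwa [Equiv.Perm.inv_eq_iff_eq, Equiv.Perm.inv_eq_iff_eq] at this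
  choose r hr k hk e using hK
  let f : ℕ → ℕ := fun x => (Φ ⟨k x, hk x⟩ : Equiv.Perm ℕ) (r x)
  have hf : ∀ a ∈ K, ∀ g : G, f ((g : Equiv.Perm ℕ) a) = (Φ g : Equiv.Perm ℕ) a :=
    fun a ha g => (key2 _ (hr _) a ha _ g).2 (e _)
  have hbij : Function.Bijective f := by
    constructor
    · intro x y hxy
      rw [← e x, ← e y]
      exact (key2 _ (hr x) _ (hr y) ⟨k x, hk x⟩ ⟨k y, hk y⟩).1 hxy
    · intro y
      refine ⟨(Φ.symm ⟨k y, hk y⟩ : Equiv.Perm ℕ) (r y), ?_⟩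
      rw [hf _ (hr y), ContinuousMulEquiv.apply_symm_apply]
      exact e y
  let π : Equiv.Perm ℕ := Equiv.ofBijective f hbij
  have hπ : ∀ g : G, π * g = Φ g * π := by
    intro g
    ext x
    change f ((g : Equiv.Perm ℕ) x) = (Φ g : Equiv.Perm ℕ) (f x)
    have := hf (r x) (hr x) (g * ⟨k x, hk x⟩)
    rw [map_mul] at this
    change f ((g : Equiv.Perm ℕ) (k x (r x))) = (Φ g : Equiv.Perm ℕ) (f x) at this
    rwa [e x] at this
  have hN : π ∈ NG G := by
    refine Subgroup.mem_normalizer_iff.2 fun g => ⟨fun hg => ?_, fun hg => ?_⟩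
    · rw [hπ ⟨g, hg⟩, mul_inv_cancel_right]
      exact (Φ _).2
    · have h1 := hπ (Φ.symm ⟨_, hg⟩)
      rw [ContinuousMulEquiv.apply_symm_apply] at h1
      have h2 : π * (Φ.symm ⟨_, hg⟩ : Equiv.Perm ℕ) = π * g := by
        rw [h1]; simp
      rw [← mul_left_cancel h2]
      exact (Φ.symm _).2
  refine ⟨⟨π, hN⟩, ?_, fun a ha => hf a ha 1 |>.trans (by rw [map_one]; rfl)⟩
  ext g : 2
  change π * g * π⁻¹ = Φ g
  rw [hπ, mul_inv_cancel_right]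

theorem IsOligomorphic.isOpenMap_R (hG : IsOligomorphic G) : IsOpenMap (R G) := by
  rw [IsTopologicalGroup.isOpenMap_iff_nhds_one]
  intro s hs
  obtain ⟨F, hF⟩ := exists_pointwiseFixer_subset (mem_map.1 hs)
  obtain ⟨T, hT⟩ := hG.exists_finset_orbits
  have hV : ⋂ a ∈ T ∪ F, ⋂ b ∈ T ∪ F,
      {Φ : TopAut G | Φ '' transporter G a b = transporter G a b} ∈
      𝓝 (1 : TopAut G) :=
    (biInter_finset_mem _).2 fun a _ => (biInter_finset_mem _).2 fun b _ =>
      transporter_cylinder_mem_nhds a b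
  refine mem_of_superset hV fun Φ hΦ => ?_
  simp only [Set.mem_iInter] at hΦ
  obtain ⟨π, rfl, hπ⟩ := exists_R_eq (K := T ∪ F) (fun x => by
    obtain ⟨a, ha, h⟩ := hT x
    exact ⟨a, Finset.mem_union_left _ ha, h⟩) Φ hΦ
  exact hF fun a ha => hπ a (Finset.mem_union_right _ ha)

end Open

/-! ### The homomorphism `R` is continuous -/

section Continuous

variable {G : Subgroup (Equiv.Perm ℕ)}

/-- A coset `gU` of an open subgroup is invariant under `gUg⁻¹` on the left and under `U` on the
right, hence under the pointwise stabiliser of some finite set on both sides. -/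
theorem exists_pointwiseFixer_mul_mem {A : Set G} (hA : A ∈ openCosets G) :
    ∃ F : Finset ℕ, ∀ h ∈ A, ∀ u ∈ pointwiseFixer G F, ∀ v ∈ pointwiseFixer G F, u * h * v ∈ A := by
  obtain ⟨U, g, hU, rfl⟩ := hA
  have h1 : (U : Set G) ∈ 𝓝 1 := hU.mem_nhds U.one_mem
  have h2 : (fun x : G => g⁻¹ * x * g) ⁻¹' (U : Set G) ∈ 𝓝 1 :=
    (hU.preimage (by fun_prop)).mem_nhds (by simp)
  obtain ⟨F, hF⟩ := exists_pointwiseFixer_subset (inter_mem h1 h2)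
  refine ⟨F, ?_⟩
  rintro _ ⟨w, hw, rfl⟩ u hu v hv
  refine ⟨g⁻¹ * u * g * w * v, ?_, by group⟩
  exact U.mul_mem (U.mul_mem (hF hu).2 hw) (hF hv).1

/-- An open coset `A` is a union of double cosets of a pointwise stabiliser `G_F`; the double coset
of `h` is determined by the orbit of the tuple `(a, h a)`, `a ∈ F`, so finitely many occur. A
`π ∈ N_G` that fixes `F` and the points `h a`, for finitely many representatives `h`, preserves
each of these double cosets under conjugation, and so preserves `A`. -/
theorem IsOligomorphic.continuous_R (hG : IsOligomorphic G) : Continuous (R G) := by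
  refine continuous_of_continuousAt_one _ ?_
  rw [ContinuousAt, map_one]
  refine TopologicalSpace.tendsto_nhds_generateFrom_iff.2 ?_
  rintro _ ⟨A, hA, Φ, rfl⟩ h1
  have h1' : A = Φ '' A := by
    have : (1 : TopAut G) '' A = Φ '' A := h1
    rw [← this]
    exact (Set.image_id A).symm
  rw [← h1']
  obtain ⟨F, hF⟩ := exists_pointwiseFixer_mul_mem hA
  obtain ⟨K, hK, hK'⟩ := hG.exists_finite_reps (F.disjSum F)
    (fun (h : A) => Sum.elim (fun a => a) fun a => (h : Equiv.Perm ℕ) a)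
  let E : Finset ℕ := F ∪ hK.toFinset.biUnion fun h => F.image fun a => (h : Equiv.Perm ℕ) a
  have sub : ∀ π ∈ pointwiseFixer (NG G) E, ∀ h ∈ A, R G π h ∈ A := by
    intro π hπ h hh
    obtain ⟨k, hk, g, hg, e⟩ := hK' ⟨h, hh⟩
    have e1 : ∀ a ∈ F, g a = a := fun a ha => e (Sum.inl a) (by simpa using ha)
    have e2 : ∀ a ∈ F, g ((h : Equiv.Perm ℕ) a) = (k : Equiv.Perm ℕ) a :=
      fun a ha => e (Sum.inr a) (by simpa using ha)
    have p1 : ∀ a ∈ F, (π : Equiv.Perm ℕ) a = a := fun a ha => hπ a (Finset.mem_union_left _ ha)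
    have p2 : ∀ a ∈ F, (π : Equiv.Perm ℕ) ((k : Equiv.Perm ℕ) a) = (k : Equiv.Perm ℕ) a :=
      fun a ha => hπ _ (Finset.mem_union_right _ (Finset.mem_biUnion.2
        ⟨k, by simpa using hk, Finset.mem_image_of_mem _ ha⟩))
    have hR : ∀ w ∈ pointwiseFixer G F, R G π w ∈ pointwiseFixer G F := by
      intro w hw a ha
      change (π : Equiv.Perm ℕ) ((w : Equiv.Perm ℕ) ((π : Equiv.Perm ℕ)⁻¹ a)) = a
      rw [Equiv.Perm.inv_eq_iff_eq.2 (p1 a ha).symm, hw a ha, p1 a ha]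
    have hu : (⟨g, hg⟩ : G) ∈ pointwiseFixer G F := e1
    have hv : (k : G)⁻¹ * ⟨g, hg⟩ * h ∈ pointwiseFixer G F := by
      intro a ha
      change (k : Equiv.Perm ℕ)⁻¹ (g ((h : Equiv.Perm ℕ) a)) = a
      rw [e2 a ha, perm_inv_apply_self]
    have hk' : (k : G)⁻¹ * R G π k ∈ pointwiseFixer G F := by
      intro a ha
      change (k : Equiv.Perm ℕ)⁻¹ ((π : Equiv.Perm ℕ) ((k : Equiv.Perm ℕ)
        ((π : Equiv.Perm ℕ)⁻¹ a))) = a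
      rw [Equiv.Perm.inv_eq_iff_eq.2 (p1 a ha).symm, p2 a ha, perm_inv_apply_self]
    -- `R(π)` maps `h = g⁻¹ k (k⁻¹ g h)` into the same double coset, since `k⁻¹ R(π)(k)` fixes `F`
    have hmem := hF k k.2 _ (inv_mem (hR _ hu)) _ (mul_mem hk' (hR _ hv))
    have heq : (R G π ⟨g, hg⟩)⁻¹ * k * ((k : G)⁻¹ * R G π k *
        R G π ((k : G)⁻¹ * ⟨g, hg⟩ * h)) = R G π h := by
      simp only [map_mul, map_inv]
      group
    rwa [heq] at hmem
  refine mem_of_superset ((isOpen_pointwiseFixer (NG G) E).mem_nhds (one_mem _)) fun π hπ => ?_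
  change R G π '' A = A
  refine Set.Subset.antisymm ?_ fun h hh => ⟨R G π⁻¹ h, sub _ (inv_mem hπ) h hh, ?_⟩
  · rintro _ ⟨h, hh, rfl⟩
    exact sub π hπ h hh
  · rw [← TopAut.mul_apply, ← map_mul, mul_inv_cancel, map_one, TopAut.one_apply]

end Continuous

/-! ### Compactness of `N_G/GC_G` -/

section Compact

variable {G : Subgroup (Equiv.Perm ℕ)}

/-- The finite relation `f` is a piece of a limit of `𝓕` modulo `G`: for almost every `ρ` along
`𝓕`, some element of `G ρ` sends `x` to `y` for every pair `(x, y) ∈ f`. -/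
def IsLimitRel (𝓕 : Ultrafilter (NG G)) (f : Finset (ℕ × ℕ)) : Prop :=
  ∀ᶠ ρ : NG G in 𝓕, ∃ g ∈ G, ∀ p ∈ f, g ((ρ : Equiv.Perm ℕ) p.1) = p.2

variable {𝓕 : Ultrafilter (NG G)} {f : Finset (ℕ × ℕ)}

/-- The orbit of the tuple `ρ` restricted to the domain of `f` and to `x` is constant along `𝓕`;
an element of it that extends `f` provides `y`. -/
theorem IsLimitRel.forth (hG : IsOligomorphic G) (hf : IsLimitRel 𝓕 f) (x : ℕ) :
    ∃ y, IsLimitRel 𝓕 (insert (x, y) f) := by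
  obtain ⟨σ, hσ⟩ := hG.exists_eventually 𝓕 (insert x (f.image Prod.fst))
    fun (ρ : NG G) a => (ρ : Equiv.Perm ℕ) a
  obtain ⟨ρ₀, ⟨g₀, hg₀, e₀⟩, ⟨g, hg, e⟩⟩ := (hf.and hσ).exists
  refine ⟨g₀ (g⁻¹ ((σ : Equiv.Perm ℕ) x)), hσ.mono ?_⟩
  rintro ρ ⟨k, hk, ek⟩
  refine ⟨g₀ * g⁻¹ * k, mul_mem (mul_mem hg₀ (inv_mem hg)) hk, fun p hp => ?_⟩
  change g₀ (g⁻¹ (k ((ρ : Equiv.Perm ℕ) p.1))) = p.2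
  rcases Finset.mem_insert.1 hp with rfl | hp
  · rw [ek _ (Finset.mem_insert_self _ _)]
  · have hm : p.1 ∈ insert x (f.image Prod.fst) :=
      Finset.mem_insert_of_mem (Finset.mem_image_of_mem _ hp)
    rw [ek _ hm, ← e _ hm, perm_inv_apply_self, e₀ _ hp]

/-- With `γ ρ ∈ G` chosen such that `γ ρ ∘ ρ` extends `f`, the orbit of the tuple `(γ ρ ∘ ρ)⁻¹`
restricted to the range of `f` and to `y` is constant along `𝓕`; an element of it that extends the
inverse of `f` provides `x`. This uses that `ρ` normalises `G`. -/
theorem IsLimitRel.back (hG : IsOligomorphic G) (hf : IsLimitRel 𝓕 f) (y : ℕ) :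
    ∃ x, IsLimitRel 𝓕 (insert (x, y) f) := by
  obtain ⟨γ, hγ⟩ := Filter.Eventually.choice hf
  obtain ⟨σ, hσ⟩ := hG.exists_eventually 𝓕 (insert y (f.image Prod.snd))
    fun (ρ : NG G) b => (ρ : Equiv.Perm ℕ)⁻¹ ((γ ρ)⁻¹ b)
  have inv : ∀ ρ : NG G, (∀ p ∈ f, γ ρ ((ρ : Equiv.Perm ℕ) p.1) = p.2) →
      ∀ p ∈ f, (ρ : Equiv.Perm ℕ)⁻¹ ((γ ρ)⁻¹ p.2) = p.1 := fun ρ h p hp => by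
    rw [← h p hp, perm_inv_apply_self, perm_inv_apply_self]
  obtain ⟨ρ₀, ⟨-, e₀⟩, ⟨h₀, hh₀, e⟩⟩ := (hγ.and hσ).exists
  refine ⟨h₀⁻¹ ((σ : Equiv.Perm ℕ)⁻¹ ((γ σ)⁻¹ y)), (hγ.and hσ).mono ?_⟩
  rintro ρ ⟨⟨hγρ, eρ⟩, h, hh, eh⟩
  have hc := conj_mem G ρ.2 (mul_mem (inv_mem hh) hh₀)
  refine ⟨γ ρ * ((ρ : Equiv.Perm ℕ) * (h⁻¹ * h₀) * (ρ : Equiv.Perm ℕ)⁻¹), mul_mem hγρ hc,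
    fun p hp => ?_⟩
  change γ ρ ((ρ : Equiv.Perm ℕ) (h⁻¹ (h₀ ((ρ : Equiv.Perm ℕ)⁻¹ ((ρ : Equiv.Perm ℕ) p.1))))) = p.2
  rw [perm_inv_apply_self]
  rcases Finset.mem_insert.1 hp with rfl | hp
  · rw [perm_apply_inv_self, ← eh _ (Finset.mem_insert_self _ _),
      perm_inv_apply_self, perm_apply_inv_self, perm_apply_inv_self]
  · have hm : p.2 ∈ insert y (f.image Prod.snd) :=
      Finset.mem_insert_of_mem (Finset.mem_image_of_mem _ hp)
    have e1 := e _ hm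
    have e2 := eh _ hm
    rw [inv ρ₀ e₀ p hp] at e1
    rw [inv ρ eρ p hp] at e2
    rw [e1, ← e2, perm_inv_apply_self, eρ p hp]

/-- Every ultrafilter on `N_G` converges, modulo `G`, to a permutation: a chain of finite
relations built back and forth has the graph of a permutation as its union. -/
theorem exists_limit_perm (hG : IsOligomorphic G) (𝓕 : Ultrafilter (NG G)) :
    ∃ π : Equiv.Perm ℕ, ∀ s : Finset ℕ, ∀ᶠ ρ : NG G in 𝓕,
      ∃ g ∈ G, ∀ a ∈ s, g ((ρ : Equiv.Perm ℕ) a) = π a := by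
  have step : ∀ (f : {f // IsLimitRel 𝓕 f}) (n : ℕ), ∃ f' : {f // IsLimitRel 𝓕 f},
      f.1 ⊆ f'.1 ∧ (∃ y, (n, y) ∈ f'.1) ∧ ∃ x, (x, n) ∈ f'.1 := by
    rintro ⟨f, hf⟩ n
    obtain ⟨y, hy⟩ := hf.forth hG n
    obtain ⟨x, hx⟩ := hy.back hG n
    exact ⟨⟨_, hx⟩, (Finset.subset_insert _ _).trans (Finset.subset_insert _ _),
      ⟨y, by simp⟩, ⟨x, by simp⟩⟩
  choose next h_sub h_dom h_ran using step
  have h0 : IsLimitRel 𝓕 ∅ := Filter.Eventually.of_forall fun ρ => ⟨1, one_mem _, by simp⟩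
  let c : ℕ → {f // IsLimitRel 𝓕 f} := fun n => Nat.rec ⟨∅, h0⟩ (fun n f => next f n) n
  have hc : Monotone fun n => (c n).1 := monotone_nat_of_le_succ fun n => h_sub (c n) n
  have hdom : ∀ x, ∃ y, (x, y) ∈ (c (x + 1)).1 := fun x => h_dom (c x) x
  have hran : ∀ y, ∃ x, (x, y) ∈ (c (y + 1)).1 := fun y => h_ran (c y) y
  choose F hF using hdom
  choose B hB using hran
  have hinj : ∀ m n x y x' y', (x, y) ∈ (c m).1 → (x', y') ∈ (c n).1 → (x = x' ↔ y = y') := by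
    intro m n x y x' y' h h'
    obtain ⟨ρ, g, -, hg⟩ := (c (max m n)).2.exists
    have e1 : g ((ρ : Equiv.Perm ℕ) x) = y := hg _ (hc (le_max_left m n) h)
    have e2 : g ((ρ : Equiv.Perm ℕ) x') = y' := hg _ (hc (le_max_right m n) h')
    rw [← e1, ← e2, g.apply_eq_iff_eq, Equiv.apply_eq_iff_eq]
  let π : Equiv.Perm ℕ :=
    { toFun := F
      invFun := B
      left_inv := fun x => (hinj (F x + 1) (x + 1) (B (F x)) (F x) x (F x)
        (hB (F x)) (hF x)).2 rfl
      right_inv := fun y => (hinj (B y + 1) (y + 1) (B y) (F (B y)) (B y) y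
        (hF (B y)) (hB y)).1 rfl }
  refine ⟨π, fun s => (c (s.sup id + 1)).2.mono ?_⟩
  rintro ρ ⟨g, hg, e⟩
  exact ⟨g, hg, fun a ha => e (a, F a)
    (hc (Nat.succ_le_succ (Finset.le_sup (f := id) ha)) (hF a))⟩

/-- The limit normalises `G`, because its conjugates of elements of `G` agree, on each finite set,
with conjugates by elements of `N_G`, and `G` is closed. -/
theorem exists_limit (hG : IsOligomorphic G) (𝓕 : Ultrafilter (NG G)) :
    ∃ π : NG G, ∀ s : Finset ℕ, ∀ᶠ ρ : NG G in 𝓕,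
      ∃ g ∈ G, ∀ a ∈ s, g ((ρ : Equiv.Perm ℕ) a) = (π : Equiv.Perm ℕ) a := by
  obtain ⟨π, hπ⟩ := exists_limit_perm hG 𝓕
  suffices hN : π ∈ NG G from ⟨⟨π, hN⟩, hπ⟩
  have conj : ∀ h ∈ G, π⁻¹ * h * π ∈ G := by
    intro h hh
    refine mem_of_isClosed hG.isClosed fun s => ?_
    obtain ⟨ρ, g, hg, e⟩ := (hπ (s ∪ s.image (π⁻¹ * h * π))).exists
    refine ⟨_, inv_conj_mem G ρ.2 (mul_mem (mul_mem (inv_mem hg) hh) hg), fun a ha => ?_⟩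
    change (ρ : Equiv.Perm ℕ)⁻¹ (g⁻¹ (h (g ((ρ : Equiv.Perm ℕ) a)))) = (π⁻¹ * h * π) a
    rw [e a (Finset.mem_union_left _ ha), Equiv.Perm.inv_eq_iff_eq, Equiv.Perm.inv_eq_iff_eq,
      e _ (Finset.mem_union_right _ (Finset.mem_image_of_mem _ ha))]
    simp
  have conj' : ∀ h ∈ G, π * h * π⁻¹ ∈ G := by
    intro h hh
    refine mem_of_isClosed hG.isClosed fun s => ?_
    obtain ⟨ρ, g, hg, e⟩ := (hπ (s.image ⇑π⁻¹ ∪ s.image (h * π⁻¹ : Equiv.Perm ℕ))).exists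
    refine ⟨_, mul_mem (mul_mem hg (conj_mem G ρ.2 hh)) (inv_mem hg), fun b hb => ?_⟩
    change g ((ρ : Equiv.Perm ℕ) (h ((ρ : Equiv.Perm ℕ)⁻¹ (g⁻¹ b)))) = π ((h * π⁻¹) b)
    have e1 := e _ (Finset.mem_union_left _ (Finset.mem_image_of_mem _ hb))
    have e2 := e _ (Finset.mem_union_right _ (Finset.mem_image_of_mem _ hb))
    rw [perm_apply_inv_self, ← Equiv.Perm.eq_inv_iff_eq, ← Equiv.Perm.eq_inv_iff_eq] at e1
    rw [← e1]
    exact e2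
  refine Subgroup.mem_normalizer_iff.2 fun h => ⟨conj' h, fun hh => ?_⟩
  have := conj _ hh
  rwa [show π⁻¹ * (π * h * π⁻¹) * π = h by group] at this

theorem IsOligomorphic.compactSpace_quotient (hG : IsOligomorphic G) :
    CompactSpace (NG G ⧸ GC G) := by
  refine ⟨isCompact_iff_ultrafilter_le_nhds.2 fun 𝓤 _ => ?_⟩
  let 𝓕 : Ultrafilter (NG G) := 𝓤.map Quotient.out
  have h𝓕 : Filter.map (QuotientGroup.mk : NG G → NG G ⧸ GC G) 𝓕 = 𝓤 := by
    rw [Ultrafilter.coe_map, Filter.map_map,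
      show QuotientGroup.mk ∘ Quotient.out = (id : NG G ⧸ GC G → _) from
        funext QuotientGroup.out_eq', Filter.map_id]
  obtain ⟨π, hπ⟩ := exists_limit hG 𝓕
  refine ⟨QuotientGroup.mk π, Set.mem_univ _, ?_⟩
  rw [← h𝓕]
  intro U hU
  obtain ⟨s, hs⟩ := mem_nhds_subgroup.1
    (QuotientGroup.continuous_mk.continuousAt.preimage_mem_nhds hU)
  refine (hπ s).mono ?_
  rintro ρ ⟨g, hg, e⟩
  have hgN : g ∈ NG G := Subgroup.le_normalizer hg
  have h1 : (QuotientGroup.mk ((⟨g, hgN⟩ : NG G) * ρ) : NG G ⧸ GC G) ∈ U := hs e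
  have h2 : (QuotientGroup.mk (⟨g, hgN⟩ : NG G) : NG G ⧸ GC G) = 1 :=
    (QuotientGroup.eq_one_iff _).2 ((mem_GC G).2 ⟨g, hg, 1, one_mem _, by simp⟩)
  rwa [QuotientGroup.mk_mul, h2, one_mul] at h1

end Compact

/-! ### The quotients of `N_G`, `range(R)` and `Aut(G)` -/

section Quotients

variable {G : Subgroup (Equiv.Perm ℕ)}

/-- `R` is an open quotient map onto its range, and `G C_G` is the preimage of `Inn(G)`. -/
theorem IsOligomorphic.exists_quotientEquiv (hG : IsOligomorphic G) :
    ∃ e : (NG G ⧸ GC G) ≃ₜ* RangeModInn G, ∀ π : NG G,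
      e (QuotientGroup.mk π) = QuotientGroup.mk ((R G).rangeRestrict π) := by
  let φ : (NG G ⧸ GC G) →* RangeModInn G :=
    QuotientGroup.map (GC G) ((Inn G).subgroupOf (R G).range) (R G).rangeRestrict
      fun _ h => (mem_GC_iff_R_mem_Inn G).1 h
  have hφ : Function.Bijective φ := by
    constructor
    · refine (injective_iff_map_eq_one φ).2 fun x hx => ?_
      obtain ⟨π, rfl⟩ := QuotientGroup.mk_surjective x
      have h1 : (R G).rangeRestrict π ∈ (Inn G).subgroupOf (R G).range :=
        (QuotientGroup.eq_one_iff _).1 hx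
      exact (QuotientGroup.eq_one_iff _).2 ((mem_GC_iff_R_mem_Inn G).2 h1)
    · intro y
      obtain ⟨⟨_, π, rfl⟩, rfl⟩ := QuotientGroup.mk_surjective y
      exact ⟨QuotientGroup.mk π, rfl⟩
  have hR : IsOpenQuotientMap (R G).rangeRestrict :=
    ⟨(R G).rangeRestrict_surjective, hG.continuous_R.subtype_mk _,
      hG.isOpenMap_R.subtype_mk _⟩
  have hq := (QuotientGroup.isOpenQuotientMap_mk
    (N := (Inn G).subgroupOf (R G).range)).comp hR
  refine ⟨(MulEquiv.ofBijective φ hφ).toContinuousMulEquiv fun s => ?_, fun π => rfl⟩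
  rw [← hq.isQuotientMap.isOpen_preimage,
    ← QuotientGroup.isOpenQuotientMap_mk.isQuotientMap.isOpen_preimage]
  rfl

theorem isOpenEmbedding_rangeModInnToOut (hR : IsOpen ((R G).range : Set (TopAut G))) :
    IsOpenEmbedding (rangeModInnToOut G) := by
  have hq := QuotientGroup.isOpenQuotientMap_mk (N := (Inn G).subgroupOf (R G).range)
  refine .of_continuous_injective_isOpenMap ?_ ?_ ?_
  · exact hq.isQuotientMap.continuous_iff.2
      (QuotientGroup.continuous_mk.comp continuous_subtype_val)
  · refine (injective_iff_map_eq_one _).2 fun x hx => ?_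
    obtain ⟨Φ, rfl⟩ := QuotientGroup.mk_surjective x
    exact (QuotientGroup.eq_one_iff _).2 ((QuotientGroup.eq_one_iff (Φ : TopAut G)).1 hx)
  · intro s hs
    have : rangeModInnToOut G '' s = QuotientGroup.mk '' (Subtype.val ''
        ((QuotientGroup.mk : (R G).range → RangeModInn G) ⁻¹' s)) := by
      conv_lhs => rw [← Set.image_preimage_eq s hq.surjective]
      rw [Set.image_image, Set.image_image]
      rfl
    rw [this]
    exact QuotientGroup.isOpenMap_coe _
      (hR.isOpenMap_subtype_val _ (hs.preimage hq.continuous))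

end Quotients

end OligoAut

open OligoAut in
theorem theorem3p10 (G : Subgroup (Equiv.Perm ℕ)) (hG : IsOligomorphic G) :
    -- the range of `R` is open in `Aut(G)`
    IsOpen ((R G).range : Set (TopAut G)) ∧
    -- `Out(G)` is a totally disconnected, locally compact (Hausdorff) topological group
    IsTopologicalGroup (Out G) ∧ T2Space (Out G) ∧
      TotallyDisconnectedSpace (Out G) ∧ LocallyCompactSpace (Out G) ∧
    -- `range(R)/Inn(G)` is a profinite group
    IsTopologicalGroup (RangeModInn G) ∧ CompactSpace (RangeModInn G) ∧
      T2Space (RangeModInn G) ∧ TotallyDisconnectedSpace (RangeModInn G) ∧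
    -- it is, as a topological group, an open subgroup of `Out(G)` in the canonical way
    Topology.IsOpenEmbedding (rangeModInnToOut G) ∧
    -- `R` induces an isomorphism of topological groups `N_G/GC_G ≅ range(R)/Inn(G)`
    ∃ e : (NG G ⧸ GC G) ≃ₜ* RangeModInn G, ∀ π : NG G,
      e (QuotientGroup.mk π) = QuotientGroup.mk ((R G).rangeRestrict π) := by
  have hRange : IsOpen ((R G).range : Set (TopAut G)) := by
    rw [MonoidHom.coe_range]
    exact hG.isOpenMap_R.isOpen_range
  have hEmb := isOpenEmbedding_rangeModInnToOut hRange
  obtain ⟨e, he⟩ := hG.exists_quotientEquiv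
  have : CompactSpace (NG G ⧸ GC G) := hG.compactSpace_quotient
  have hClosed : IsClosed (GC G : Set (NG G)) := hG.isClosed_GC
  have : NonarchimedeanGroup (NG G ⧸ GC G) := nonarchimedean_quotient _ _
  have : NonarchimedeanGroup (RangeModInn G) :=
    NonarchimedeanGroup.nonarchimedean_of_emb (e : (NG G ⧸ GC G) →* RangeModInn G)
      e.toHomeomorph.isOpenEmbedding
  have : NonarchimedeanGroup (Out G) :=
    NonarchimedeanGroup.nonarchimedean_of_emb (rangeModInnToOut G) hEmb
  have : T2Space (RangeModInn G) := e.toHomeomorph.symm.isEmbedding.t2Space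
  have : CompactSpace (RangeModInn G) := e.toHomeomorph.compactSpace
  -- an open subgroup is closed, so `1` is closed in `Out(G)` because it is in `range(R)/Inn(G)`
  have hRangeClosed : IsClosed (Set.range (rangeModInnToOut G)) :=
    Subgroup.isClosed_of_isOpen (rangeModInnToOut G).range hEmb.isOpen_range
  have hOne : IsClosed ({1} : Set (Out G)) := by
    have := (Topology.IsClosedEmbedding.mk hEmb.isEmbedding hRangeClosed).isClosedMap _
      (isClosed_singleton (x := 1))
    rwa [Set.image_singleton, map_one] at this
  have : T1Space (Out G) := IsTopologicalGroup.t1Space _ hOne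
  have : T2Space (Out G) := inferInstance
  have : LocallyCompactSpace (Out G) :=
    (isCompact_range hEmb.continuous).locallyCompactSpace_of_mem_nhds_of_group
      (hEmb.isOpen_range.mem_nhds ⟨1, rfl⟩)
  exact ⟨hRange, inferInstance, inferInstance, inferInstance, inferInstance, inferInstance,
    inferInstance, inferInstance, inferInstance, hEmb, e, he⟩
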